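/- Let $N\in\mathbb N$, natural frequencies $\Omega=(\Omega_1,\dots,\Omega_N)\in\mathbb R^N$, initial phases $\Theta_0\in\mathbb R^N$, a coupling strength $K>0$, a constant $c>0$ and $\alpha\in(\tfrac12,1)$ be given. For $\theta\in\mathbb R$ let $|\theta|_o$ be the absolute value of the representative of $\theta$ modulo $2\pi$ in $(-\pi,\pi]$, and define the regularized and singular kernels $$h_\varepsilon(\theta)=\frac{\sin\theta}{(\varepsilon^2+c|\theta|_o^2)^\alpha}\quad(\varepsilon>0),\qquad h(\theta)=\frac{\sin\theta}{c^\alpha|\theta|_o^{2\alpha}}\ \text{ for }\theta\notin 2\pi\mathbb Z,\quad h=0\ \text{ on } 2\pi\mathbb Z,$$ the vector fields $H^\varepsilon,H:\mathbb R^N\to\mathbb R^N$, $$H^\varepsilon_i(\Theta)=\Omega_i+\frac KN\sum_{j=1}^N h_\varepsilon(\theta_j-\theta_i),\qquad H_i(\Theta)=\Omega_i+\frac KN\sum_{j=1}^N h(\theta_j-\theta_i),$$ and the interaction potentials $$V^\varepsilon_{int}(\Theta)=\frac K{2N}\sum_{i\ne j}\int_0^{\theta_i-\theta_j}h_\varepsilon(s)\,ds,\qquad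 V_{int}(\Theta)=\frac K{2N}\sum_{i\ne j}\int_0^{\theta_i-\theta_j}h(s)\,ds .$$ Let $\mathcal H$ be the Filippov set-valued map of $H$, $$\mathcal H(\Theta)=\bigcap_{\delta>0}\ \bigcap_{|\mathcal N|=0}\overline{\mathrm{co}}\,\bigl(H(B_\delta(\Theta)\setminus\mathcal N)\bigr).$$ For every $\varepsilon>0$ let $\Theta^\varepsilon:[0,\infty)\to\mathbb R^N$ be the classical solution of $\dot\Theta^\varepsilon=H^\varepsilon(\Theta^\varepsilon)$, $\Theta^\varepsilon(0)=\Theta_0$. Then: 1. This system is the gradient flow $\dot\Theta^\varepsilon=-\nabla V^\varepsilon(\Theta^\varepsilon)$ of $V^\varepsilon(\Theta)=-\sum_i\Omega_i\theta_i+V^\varepsilon_{int}(\Theta)$, that is, $-\nabla V^\varepsilon=H^\varepsilon$ for every $\varepsilon>0$. 2. (Energy estimate.) For all $\varepsilon>0$ and $t>0$, $$\frac12\int_0^t|\dot\Theta^\varepsilon(s)|^2\,ds\le\frac{|\Omega|^2}{2}\,t+V_{int}(\Theta_0).$$ 3. (Boundedness in $H^1_{loc}$.) For every $T>0$ there is a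 constant $C$ such that $\Theta^\varepsilon\in H^1((0,T),\mathbb R^N)$ and $\|\Theta^\varepsilon\|_{H^1((0,T),\mathbb R^N)}\le C$ for all $\varepsilon>0$. 4. (Singular limit.) Let $\varepsilon_n>0$, $\varepsilon_n\to0$, and let $\Theta\in H^1_{loc}$ be such that $\Theta^{\varepsilon_n}\rightharpoonup\Theta$ weakly in $H^1((0,T),\mathbb R^N)$ for every $T>0$. Then $$\dot\Theta(t)\in\mathcal H(\Theta(t))\quad\text{for a.e. }t\ge0,$$ where $\dot\Theta$ is the weak derivative. Consequently $\Theta$ is a Filippov solution of the singular system: it coincides almost everywhere on $(0,\infty)$ with a function $\Phi:[0,\infty)\to\mathbb R^N$ that is absolutely continuous on every $[0,T]$, satisfies $\Phi(0)=\Theta_0$, and is differentiable with $\dot\Phi(t)\in\mathcal H(\Phi(t))$ for a.e. $t\ge0$. -/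

import Mathlib

open Set Filter Topology MeasureTheory
open scoped ContDiff ENNReal

namespace SingularKuramoto

/-- The phase space `ℝ^N` with its Euclidean norm. -/
abbrev Phase (N : ℕ) : Type := EuclideanSpace ℝ (Fin N)

/-! ### Kernels, vector fields and potentials -/

/-- The orthodromic distance `|θ|_o` to zero: the absolute value of the representative of `θ`
modulo `2π` in `(-π, π]`. -/
noncomputable def orthoDist (θ : ℝ) : ℝ := |(θ : Real.Angle).toReal|

/-- The regularized kernel `h_ε(θ) = sin θ / (ε² + c |θ|_o²)^α`. -/
noncomputable def regKernel (α c ε : ℝ) (θ : ℝ) : ℝ :=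
  Real.sin θ / (ε ^ 2 + c * orthoDist θ ^ 2) ^ α

/-- The singular kernel `h(θ) = sin θ / (c^α |θ|_o^(2α))` (with value `0` on `2πℤ`). -/
noncomputable def singKernel (α c : ℝ) (θ : ℝ) : ℝ :=
  Real.sin θ / (c ^ α * orthoDist θ ^ (2 * α))

/-- The Kuramoto vector field with kernel `k`: the `i`-th component is
`Ω_i + (K/N) ∑_j k(θ_j - θ_i)`. -/
noncomputable def vectorField {N : ℕ} (Ω : Phase N) (K : ℝ) (k : ℝ → ℝ) (x : Phase N) : Phase N :=
  WithLp.toLp 2 fun i => Ω i + K / N * ∑ j, k (x j - x i)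

/-- The interaction potential `V_int(Θ) = (K/2N) ∑_{i ≠ j} W(θ_i - θ_j)`, where
`W(θ) = ∫_0^θ k` is the primitive of the kernel `k`. -/
noncomputable def interactionPotential {N : ℕ} (K : ℝ) (k : ℝ → ℝ) (x : Phase N) : ℝ :=
  K / (2 * N) * ∑ i, ∑ j ∈ Finset.univ.filter (fun j => j ≠ i), ∫ s in (0 : ℝ)..(x i - x j), k s

/-- The full potential `V(Θ) = -∑_i Ω_i θ_i + V_int(Θ)`. -/
noncomputable def potential {N : ℕ} (Ω : Phase N) (K : ℝ) (k : ℝ → ℝ) (x : Phase N) : ℝ :=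
  -(∑ i, Ω i * x i) + interactionPotential K k x

/-- `u` is a classical solution on `[0,∞)` of `u' = F(u)`, `u(0) = x₀`
(the derivative at `t = 0` is one-sided). -/
def IsClassicalSolution {N : ℕ} (F : Phase N → Phase N) (x₀ : Phase N) (u : ℝ → Phase N) : Prop :=
  u 0 = x₀ ∧ ∀ t : ℝ, 0 ≤ t → HasDerivWithinAt u (F (u t)) (Ici 0) t

/-! ### Filippov solutions -/

/-- The Filippov set-valued map of `F`: the intersection, over all `δ > 0` and all Lebesgue-null
sets `S`, of the closed convex hulls of `F (B_δ(x) \ S)`. -/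
def filippovMap {N : ℕ} (F : Phase N → Phase N) (x : Phase N) : Set (Phase N) :=
  {v | ∀ δ : ℝ, 0 < δ → ∀ S : Set (Phase N), volume S = 0 →
    v ∈ closure (convexHull ℝ (F '' (Metric.ball x δ \ S)))}

/-- A (global, forward) solution in Filippov's sense of `u' = F(u)`, `u(0) = x₀`: locally
absolutely continuous on `[0,∞)` and solving the differential inclusion almost everywhere. -/
def IsFilippovSolution {N : ℕ} (F : Phase N → Phase N) (x₀ : Phase N) (u : ℝ → Phase N) : Prop :=
  u 0 = x₀ ∧ (∀ T : ℝ, 0 < T → AbsolutelyContinuousOnInterval u 0 T) ∧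
    ∀ᵐ t ∂(volume.restrict (Ioi (0 : ℝ))), ∃ v ∈ filippovMap F (u t), HasDerivAt u v t

/-! ### The Sobolev space `H¹((0,T), ℝ^N)` and weak `H¹_loc` limits -/

/-- `L²((0,T), ℝ^N)`. -/
abbrev L2 (N : ℕ) (T : ℝ) : Type := Lp (Phase N) 2 (volume.restrict (Ioo (0 : ℝ) T))

/-- Test functions on `(0,T)`: smooth with compact support in the open interval. -/
def IsTestFunction (T : ℝ) (φ : ℝ → ℝ) : Prop :=
  ContDiff ℝ ∞ φ ∧ HasCompactSupport φ ∧ tsupport φ ⊆ Ioo 0 T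

theorem integrable_smul_L2 {N : ℕ} {T : ℝ} {φ : ℝ → ℝ} (hφ : Continuous φ)
    (hc : HasCompactSupport φ) (f : L2 N T) :
    Integrable (fun t => φ t • f t) (volume.restrict (Ioo (0 : ℝ) T)) := by
  obtain ⟨C, hC⟩ := hφ.bounded_above_of_compact_support hc
  have hf : Integrable f (volume.restrict (Ioo (0 : ℝ) T)) :=
    (Lp.memLp f).integrable (by norm_num)
  exact hf.bdd_smul C hφ.aestronglyMeasurable (Eventually.of_forall hC)

/-- `H¹((0,T), ℝ^N)`, as the space of pairs `(u, u')` in `L² × L²` where `u'` is the weak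
derivative of `u`; the norm inherited from the Hilbert sum is
`‖u‖²_{H¹} = ‖u‖²_{L²} + ‖u'‖²_{L²}`. -/
noncomputable def H1 (N : ℕ) (T : ℝ) : Submodule ℝ (WithLp 2 (L2 N T × L2 N T)) where
  carrier := {p | ∀ φ : ℝ → ℝ, IsTestFunction T φ →
    ∫ t in Ioo 0 T, deriv φ t • p.fst t = -∫ t in Ioo 0 T, φ t • p.snd t}
  zero_mem' := by
    intro φ _
    have h : ∀ ψ : ℝ → ℝ, ∫ t in Ioo 0 T, ψ t • (0 : L2 N T) t = 0 := by
      intro ψ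
      refine integral_eq_zero_of_ae ?_
      filter_upwards [Lp.coeFn_zero (Phase N) 2 (volume.restrict (Ioo (0 : ℝ) T))] with t ht
      have ht' : (0 : L2 N T) t = 0 := ht
      rw [ht', smul_zero, Pi.zero_apply]
    simp only [WithLp.zero_fst, WithLp.zero_snd, h, neg_zero]
  add_mem' := by
    intro p q hp hq φ hφ
    have h : ∀ ψ : ℝ → ℝ, Continuous ψ → HasCompactSupport ψ → ∀ f g : L2 N T,
        ∫ t in Ioo 0 T, ψ t • (f + g) t
          = (∫ t in Ioo 0 T, ψ t • f t) + ∫ t in Ioo 0 T, ψ t • g t := by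
      intro ψ h1 h2 f g
      rw [← integral_add (integrable_smul_L2 h1 h2 f) (integrable_smul_L2 h1 h2 g)]
      refine integral_congr_ae ?_
      filter_upwards [Lp.coeFn_add f g] with t ht
      rw [ht, Pi.add_apply, smul_add]
    simp only [WithLp.add_fst, WithLp.add_snd]
    rw [h _ (hφ.1.continuous_deriv (by simp)) hφ.2.1.deriv, h _ hφ.1.continuous hφ.2.1,
      hp φ hφ, hq φ hφ, neg_add]
  smul_mem' := by
    intro a p hp φ hφ
    have h : ∀ ψ : ℝ → ℝ, ∀ f : L2 N T,
        ∫ t in Ioo 0 T, ψ t • (a • f) t = a • ∫ t in Ioo 0 T, ψ t • f t := by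
      intro ψ f
      rw [← integral_smul]
      refine integral_congr_ae ?_
      filter_upwards [Lp.coeFn_smul a f] with t ht
      rw [ht, Pi.smul_apply, smul_comm]
    simp only [WithLp.smul_fst, WithLp.smul_snd]
    rw [h, h, hp φ hφ, smul_neg]

/-- The function `u` belongs to `H¹((0,T), ℝ^N)` and `p` is the corresponding element. -/
def RepresentsH1 {N : ℕ} {T : ℝ} (p : H1 N T) (u : ℝ → Phase N) : Prop :=
  u =ᵐ[volume.restrict (Ioo (0 : ℝ) T)] p.1.fst

/-- The sequence `u n` converges to `v` weakly in `H¹((0,T), ℝ^N)` for every `T > 0`, and `v'` is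
the weak derivative of `v` on `(0,∞)`. Weak convergence in `H¹((0,T), ℝ^N)` is convergence against
all continuous linear functionals. -/
def IsWeakH1LocLimit {N : ℕ} (u : ℕ → ℝ → Phase N) (v v' : ℝ → Phase N) : Prop :=
  ∀ T : ℝ, 0 < T → ∃ (p : ℕ → H1 N T) (q : H1 N T),
    (∀ n, RepresentsH1 (p n) (u n)) ∧ RepresentsH1 q v ∧
    v' =ᵐ[volume.restrict (Ioo (0 : ℝ) T)] q.1.snd ∧
    ∀ ℓ : H1 N T →L[ℝ] ℝ, Tendsto (fun n => ℓ (p n)) atTop (𝓝 (ℓ q))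

end SingularKuramoto

/- The symmetrization in the pairing of an odd kernel with a fixed vector drives every step.

Energy. The primitive of `regKernel α c ε` is even and `2π`-periodic, so on `[0, π]` its values are
seen to lie between `0` and those of the primitive of `singKernel α c`. Along the gradient flow this
bounds the `L²` norm of the velocity uniformly in `ε`; the solutions are then uniformly Hölder
continuous and a weak limit is a pointwise limit, given by the primitive `Φ` of its weak derivative.

Limit. Fix a time `t` at which `Φ` is differentiable, and a vector `w` that is constant on the
clusters of `Φ t`, the groups of oscillators whose phases agree modulo `2π`. After symmetrization
`⟪w, H^ε⟫` only sees pairs of oscillators that do not collide at time `t`, so it converges uniformly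
near `Φ t`, and `⟪w, Φ' t⟫ = ⟪w, H (Φ t)⟫`. If `w` is not constant on the clusters, then
`⟪w, H (Φ t - r w)⟫ → +∞` as `r ↓ 0`, because `h (θ) → +∞` as `θ ↓ 0` when `1 / 2 < α`. Hence no
half-space `{v | ⟪w, v⟫ ≤ a}` with `a < ⟪w, Φ' t⟫` contains the image under `H` of almost all of a
ball around `Φ t`, and `Φ' t` belongs to the Filippov set by the Hahn–Banach theorem. -/

namespace SingularKuramoto

theorem periodic_eq_of_angle_eq {β : Type*} {g : ℝ → β} (hper : Function.Periodic g (2 * Real.pi))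
    {a b : ℝ} (h : (a : Real.Angle) = b) : g a = g b := by
  obtain ⟨n, hn⟩ := Real.Angle.angle_eq_iff_two_pi_dvd_sub.1 h
  rw [eq_add_of_sub_eq' hn, mul_comm, hper.int_mul n]

theorem even_integral_of_odd {f : ℝ → ℝ} (hf : Function.Odd f) :
    Function.Even fun θ => ∫ s in (0 : ℝ)..θ, f s := fun θ => by
  have h := intervalIntegral.integral_comp_neg (a := 0) (b := θ) f
  simp only [hf _, intervalIntegral.integral_neg, neg_zero] at h
  change ∫ s in (0 : ℝ)..(-θ), f s = ∫ s in (0 : ℝ)..θ, f s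
  rw [intervalIntegral.integral_symm, ← h, neg_neg]

theorem periodic_integral_of_odd {f : ℝ → ℝ} {T : ℝ} (hf : Function.Odd f)
    (hper : Function.Periodic f T) (hint : ∀ a b, IntervalIntegrable f volume a b) :
    Function.Periodic (fun θ => ∫ s in (0 : ℝ)..θ, f s) T := fun θ => by
  have hzero : ∫ s in (-(T / 2))..(T / 2), f s = 0 := by
    rw [← intervalIntegral.integral_interval_sub_left (hint 0 _) (hint 0 _)]
    exact sub_eq_zero.2 (even_integral_of_odd hf (T / 2)).symm
  have hperiod : ∫ s in θ..(θ + T), f s = 0 := by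
    rw [hper.intervalIntegral_add_eq θ (-(T / 2)), ← hzero]
    congr 1
    ring
  change ∫ s in (0 : ℝ)..(θ + T), f s = _
  rw [← intervalIntegral.integral_add_adjacent_intervals (hint 0 θ) (hint _ _), hperiod, add_zero]

theorem intervalIntegrable_of_odd_of_periodic {f : ℝ → ℝ} {T : ℝ} (hT : T ≠ 0)
    (hf : Function.Odd f) (hper : Function.Periodic f T)
    (hint : IntervalIntegrable f volume 0 (T / 2)) (a b : ℝ) :
    IntervalIntegrable f volume a b := by
  have hneg : IntervalIntegrable f volume (-(T / 2)) 0 := by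
    rw [IntervalIntegrable.iff_comp_neg]
    simp only [hf _, neg_neg, neg_zero]
    exact hint.symm.neg
  refine hper.intervalIntegrable hT (t := -(T / 2)) ?_ a b
  convert hneg.trans hint using 1
  ring

theorem orthoDist_nonneg (θ : ℝ) : 0 ≤ orthoDist θ := abs_nonneg _

theorem orthoDist_mem_Icc (θ : ℝ) : orthoDist θ ∈ Icc 0 Real.pi :=
  ⟨orthoDist_nonneg θ, Real.Angle.abs_toReal_le_pi _⟩

theorem orthoDist_even : Function.Even orthoDist := fun θ => by
  rw [orthoDist, Real.Angle.coe_neg, Real.Angle.abs_toReal_neg, orthoDist]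

theorem orthoDist_periodic : Function.Periodic orthoDist (2 * Real.pi) := fun θ => by
  rw [orthoDist, Real.Angle.coe_add, Real.Angle.coe_two_pi, add_zero, orthoDist]

theorem orthoDist_of_mem_Icc {θ : ℝ} (h : θ ∈ Icc 0 Real.pi) : orthoDist θ = θ :=
  Real.Angle.abs_toReal_coe_eq_self_iff.2 h

theorem orthoDist_eq_zero_iff {θ : ℝ} : orthoDist θ = 0 ↔ (θ : Real.Angle) = 0 := by
  rw [orthoDist, abs_eq_zero, Real.Angle.toReal_eq_zero_iff]

theorem apply_orthoDist {β : Type*} {g : ℝ → β} (hg : Function.Even g)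
    (hper : Function.Periodic g (2 * Real.pi)) (θ : ℝ) : g (orthoDist θ) = g θ := by
  have habs (x : ℝ) : g |x| = g x := by
    rcases abs_choice x with h | h <;> rw [h]
    exact hg x
  rw [orthoDist, habs]
  exact periodic_eq_of_angle_eq hper (Real.Angle.coe_toReal _)

theorem continuous_orthoDist : Continuous orthoDist := by
  have h : orthoDist = fun θ => Real.arccos (Real.cos θ) := funext fun θ => by
    rw [← apply_orthoDist Real.cos_neg Real.cos_periodic,
      Real.arccos_cos (orthoDist_mem_Icc θ).1 (orthoDist_mem_Icc θ).2]
  rw [h]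
  exact Real.continuous_arccos.comp Real.continuous_cos

theorem integral_nonneg_of_odd_of_periodic {f : ℝ → ℝ} (hf : Function.Odd f)
    (hper : Function.Periodic f (2 * Real.pi)) (hint : ∀ a b, IntervalIntegrable f volume a b)
    (hpos : ∀ θ ∈ Icc 0 Real.pi, 0 ≤ f θ) (θ : ℝ) : 0 ≤ ∫ s in (0 : ℝ)..θ, f s := by
  rw [← apply_orthoDist (even_integral_of_odd hf) (periodic_integral_of_odd hf hper hint) θ]
  exact intervalIntegral.integral_nonneg (orthoDist_nonneg θ) fun s hs =>
    hpos s ⟨hs.1, hs.2.trans (orthoDist_mem_Icc θ).2⟩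

theorem regKernel_odd (α c ε : ℝ) : Function.Odd (regKernel α c ε) := fun θ => by
  rw [regKernel, regKernel, orthoDist_even, Real.sin_neg, neg_div]

theorem regKernel_periodic (α c ε : ℝ) : Function.Periodic (regKernel α c ε) (2 * Real.pi) :=
  fun θ => by rw [regKernel, regKernel, orthoDist_periodic, Real.sin_periodic]

theorem singKernel_odd (α c : ℝ) : Function.Odd (singKernel α c) := fun θ => by
  rw [singKernel, singKernel, orthoDist_even, Real.sin_neg, neg_div]

theorem singKernel_periodic (α c : ℝ) : Function.Periodic (singKernel α c) (2 * Real.pi) :=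
  fun θ => by rw [singKernel, singKernel, orthoDist_periodic, Real.sin_periodic]

theorem singKernel_eq_regKernel_zero (α : ℝ) {c : ℝ} (hc : 0 ≤ c) :
    singKernel α c = regKernel α c 0 := funext fun θ => by
  rw [singKernel, regKernel, Real.rpow_mul (orthoDist_nonneg θ), Real.rpow_two,
    ← Real.mul_rpow hc (sq_nonneg _), zero_pow two_ne_zero, zero_add]

theorem regKernel_nonneg (α ε : ℝ) {c θ : ℝ} (hc : 0 ≤ c) (hθ : θ ∈ Icc 0 Real.pi) :
    0 ≤ regKernel α c ε θ :=
  div_nonneg (Real.sin_nonneg_of_mem_Icc hθ) (Real.rpow_nonneg (by positivity) _)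

theorem regKernel_le_singKernel {α c θ : ℝ} (ε : ℝ) (hc : 0 < c) (hα : 0 ≤ α)
    (hθ : θ ∈ Icc 0 Real.pi) : regKernel α c ε θ ≤ singKernel α c θ := by
  rw [singKernel_eq_regKernel_zero α hc.le]
  rcases hθ.1.eq_or_lt with rfl | hpos
  · simp [regKernel]
  have hd : 0 < orthoDist θ := by rwa [orthoDist_of_mem_Icc hθ]
  have hle : (0 : ℝ) ^ 2 + c * orthoDist θ ^ 2 ≤ ε ^ 2 + c * orthoDist θ ^ 2 := by
    rw [zero_pow two_ne_zero]
    gcongr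
    positivity
  exact div_le_div_of_nonneg_left (Real.sin_nonneg_of_mem_Icc hθ)
    (Real.rpow_pos_of_pos (by positivity) _) (Real.rpow_le_rpow (by positivity) hle hα)

theorem continuousAt_regKernel (α : ℝ) {c ε θ : ℝ} (hc : 0 < c)
    (h : ε ≠ 0 ∨ (θ : Real.Angle) ≠ 0) :
    ContinuousAt (fun p : ℝ × ℝ => regKernel α c p.1 p.2) (ε, θ) := by
  have hpos : 0 < ε ^ 2 + c * orthoDist θ ^ 2 := by
    rcases h with hε | hθ
    · positivity
    · have := orthoDist_eq_zero_iff.not.2 hθ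
      positivity
  have hdenom : ContinuousAt (fun p : ℝ × ℝ => p.1 ^ 2 + c * orthoDist p.2 ^ 2) (ε, θ) := by
    have := continuous_orthoDist
    fun_prop
  exact ContinuousAt.div (by fun_prop) (hdenom.rpow_const (Or.inl hpos.ne'))
    (Real.rpow_pos_of_pos hpos _).ne'

theorem continuous_regKernel (α : ℝ) {c ε : ℝ} (hc : 0 < c) (hε : ε ≠ 0) :
    Continuous (regKernel α c ε) :=
  continuous_iff_continuousAt.2 fun _ =>
    (continuousAt_regKernel α hc (Or.inl hε)).comp₂ (g := fun _ : ℝ => ε)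
      continuousAt_const continuousAt_id

theorem continuousAt_singKernel (α : ℝ) {c θ : ℝ} (hc : 0 < c) (hθ : (θ : Real.Angle) ≠ 0) :
    ContinuousAt (singKernel α c) θ := by
  rw [singKernel_eq_regKernel_zero α hc.le]
  exact (continuousAt_regKernel α hc (Or.inr hθ)).comp₂ (g := fun _ : ℝ => 0)
    continuousAt_const continuousAt_id

theorem singKernel_eq_sinc_mul_rpow (α : ℝ) {c θ : ℝ} (hθ : θ ∈ Ioc 0 Real.pi) :
    singKernel α c θ = (c ^ α)⁻¹ * Real.sinc θ * θ ^ (1 - 2 * α) := by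
  rw [singKernel, orthoDist_of_mem_Icc (Ioc_subset_Icc_self hθ), Real.sinc_of_ne_zero hθ.1.ne',
    Real.rpow_sub hθ.1, Real.rpow_one]
  have := hθ.1.ne'
  field_simp

theorem intervalIntegrable_singKernel {α : ℝ} (c : ℝ) (hα : α < 1) (a b : ℝ) :
    IntervalIntegrable (singKernel α c) volume a b := by
  have hint : IntervalIntegrable (fun θ : ℝ => (c ^ α)⁻¹ * Real.sinc θ * θ ^ (1 - 2 * α))
      volume 0 Real.pi :=
    (intervalIntegral.intervalIntegrable_rpow' (by linarith)).continuousOn_mul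
      (continuous_const.mul Real.continuous_sinc).continuousOn
  refine intervalIntegrable_of_odd_of_periodic Real.two_pi_pos.ne' (singKernel_odd α c)
    (singKernel_periodic α c) ?_ a b
  rw [mul_div_cancel_left₀ _ two_ne_zero]
  refine hint.congr fun θ hθ => (singKernel_eq_sinc_mul_rpow α ?_).symm
  rwa [uIoc_of_le Real.pi_pos.le] at hθ

theorem tendsto_singKernel_nhdsGT_zero {α c : ℝ} (hc : 0 < c) (hα : 1 / 2 < α) :
    Tendsto (singKernel α c) (𝓝[>] 0) atTop := by
  have hsinc : Tendsto (fun θ => (c ^ α)⁻¹ * Real.sinc θ) (𝓝[>] 0) (𝓝 (c ^ α)⁻¹) := by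
    have h : Continuous fun θ => (c ^ α)⁻¹ * Real.sinc θ :=
      continuous_const.mul Real.continuous_sinc
    simpa only [Real.sinc_zero, mul_one] using h.continuousWithinAt.tendsto (x := 0)
  have hrpow : Tendsto (fun θ : ℝ => θ ^ (1 - 2 * α)) (𝓝[>] 0) atTop :=
    tendsto_rpow_neg_nhdsGT_zero (by linarith)
  refine (hsinc.pos_mul_atTop (inv_pos.2 (Real.rpow_pos_of_pos hc α)) hrpow).congr' ?_
  filter_upwards [Ioc_mem_nhdsGT Real.pi_pos] with θ hθ
  exact (singKernel_eq_sinc_mul_rpow α hθ).symm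

theorem integral_regKernel_nonneg (α : ℝ) {c ε : ℝ} (hc : 0 < c) (hε : ε ≠ 0) (θ : ℝ) :
    0 ≤ ∫ s in (0 : ℝ)..θ, regKernel α c ε s :=
  integral_nonneg_of_odd_of_periodic (regKernel_odd α c ε) (regKernel_periodic α c ε)
    (continuous_regKernel α hc hε).intervalIntegrable (fun _ => regKernel_nonneg α ε hc.le) θ

theorem integral_regKernel_le {α c ε : ℝ} (hc : 0 < c) (hα : α ∈ Ico 0 1) (hε : ε ≠ 0) (θ : ℝ) :
    ∫ s in (0 : ℝ)..θ, regKernel α c ε s ≤ ∫ s in (0 : ℝ)..θ, singKernel α c s := by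
  have hreg := (continuous_regKernel α hc hε).intervalIntegrable (μ := volume)
  have hsing := intervalIntegrable_singKernel c hα.2
  rw [← sub_nonneg, ← intervalIntegral.integral_sub (hsing _ _) (hreg _ _)]
  refine integral_nonneg_of_odd_of_periodic
    (f := fun s => singKernel α c s - regKernel α c ε s) (fun x => ?_) (fun x => ?_)
    (fun a b => (hsing a b).sub (hreg a b))
    (fun x hx => sub_nonneg.2 (regKernel_le_singKernel ε hc hα.1 hx)) θ
  · simp only [singKernel_odd α c x, regKernel_odd α c ε x]
    ring
  · simp only [singKernel_periodic α c x, regKernel_periodic α c ε x]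

section GradientStructure

variable {N : ℕ}

theorem vectorField_eq_add (Ω : Phase N) (K : ℝ) (k : ℝ → ℝ) (x : Phase N) :
    vectorField Ω K k x = Ω + vectorField 0 K k x := by
  ext i
  simp [vectorField]

theorem continuous_vectorField (Ω : Phase N) (K : ℝ) {k : ℝ → ℝ} (hk : Continuous k) :
    Continuous (vectorField Ω K k) := by
  unfold vectorField
  fun_prop

theorem sum_mul_sum_odd {ι : Type*} [Fintype ι] {k : ℝ → ℝ} (hk : Function.Odd k) (w y : ι → ℝ) :
    ∑ i, w i * ∑ j, k (y j - y i) = 1 / 2 * ∑ i, ∑ j, (w i - w j) * k (y j - y i) := by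
  have hswap : ∑ i, ∑ j, w j * k (y j - y i) = -∑ i, ∑ j, w i * k (y j - y i) := by
    rw [Finset.sum_comm]
    simp only [← Finset.sum_neg_distrib, ← mul_neg, ← hk _, neg_sub]
  simp only [sub_mul, Finset.sum_sub_distrib, hswap, Finset.mul_sum]
  ring

theorem inner_vectorField {k : ℝ → ℝ} (hk : Function.Odd k) (Ω : Phase N) (K : ℝ)
    (w y : Phase N) :
    inner ℝ w (vectorField Ω K k y) =
      inner ℝ w Ω + K / (2 * N) * ∑ i, ∑ j, (w i - w j) * k (y j - y i) := by
  have hinner : inner ℝ w (vectorField 0 K k y) = K / N * ∑ i, w i * ∑ j, k (y j - y i) := by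
    simp only [PiLp.inner_apply, vectorField, PiLp.zero_apply, zero_add, RCLike.inner_apply,
      conj_trivial]
    rw [Finset.mul_sum]
    exact Finset.sum_congr rfl fun i _ => by ring
  rw [vectorField_eq_add, inner_add_right, hinner, sum_mul_sum_odd hk]
  ring

theorem interactionPotential_eq_sum (K : ℝ) (k : ℝ → ℝ) (x : Phase N) :
    interactionPotential K k x =
      K / (2 * N) * ∑ i, ∑ j, ∫ s in (0 : ℝ)..(x i - x j), k s := by
  unfold interactionPotential
  congr 1
  refine Finset.sum_congr rfl fun i _ => Finset.sum_filter_of_ne fun j _ hj => ?_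
  rintro rfl
  rw [sub_self, intervalIntegral.integral_same] at hj
  exact hj rfl

theorem interactionPotential_mono {K : ℝ} (hK : 0 ≤ K) {k₁ k₂ : ℝ → ℝ}
    (h : ∀ θ, ∫ s in (0 : ℝ)..θ, k₁ s ≤ ∫ s in (0 : ℝ)..θ, k₂ s) (x : Phase N) :
    interactionPotential K k₁ x ≤ interactionPotential K k₂ x := by
  rw [interactionPotential_eq_sum, interactionPotential_eq_sum]
  gcongr
  exact h _

theorem interactionPotential_nonneg {K : ℝ} (hK : 0 ≤ K) {k : ℝ → ℝ}
    (h : ∀ θ, 0 ≤ ∫ s in (0 : ℝ)..θ, k s) (x : Phase N) : 0 ≤ interactionPotential K k x := by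
  rw [interactionPotential_eq_sum]
  exact mul_nonneg (by positivity)
    (Finset.sum_nonneg fun i _ => Finset.sum_nonneg fun j _ => h _)

theorem hasGradientAt_interactionPotential {k : ℝ → ℝ} (hk : Function.Odd k) (hcont : Continuous k)
    (K : ℝ) (x : Phase N) :
    HasGradientAt (interactionPotential K k) (-vectorField 0 K k x) x := by
  let π (i : Fin N) : Phase N →L[ℝ] ℝ := EuclideanSpace.proj i
  have hpair (i j : Fin N) : HasFDerivAt (fun y : Phase N => ∫ s in (0 : ℝ)..(y i - y j), k s)
      (k (x i - x j) • (π i - π j)) x := by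
    have hprim : HasDerivAt (fun θ => ∫ s in (0 : ℝ)..θ, k s) (k (x i - x j)) (x i - x j) :=
      (hcont.integral_hasStrictDerivAt 0 (x i - x j)).hasDerivAt
    exact hprim.comp_hasFDerivAt x (π i - π j).hasFDerivAt
  have hsum := (HasFDerivAt.fun_sum (u := Finset.univ) fun i _ =>
    HasFDerivAt.fun_sum (u := Finset.univ) fun j _ => hpair i j).const_mul (K / (2 * N))
  rw [hasGradientAt_iff_hasFDerivAt, funext (interactionPotential_eq_sum K k)]
  refine hsum.congr_fderiv ?_
  ext v
  have hterm (i j : Fin N) :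
      k (x i - x j) * (v i - v j) = -((v i - v j) * k (x j - x i)) := by
    rw [← neg_sub (x j) (x i), hk]
    ring
  have hπ (i : Fin N) : π i v = v i := rfl
  rw [InnerProductSpace.toDual_apply_apply, inner_neg_left, real_inner_comm, inner_vectorField hk]
  simp only [smul_apply, sum_apply, sub_apply, hπ, smul_eq_mul, hterm, Finset.sum_neg_distrib,
    inner_zero_right]
  ring

theorem potential_eq_inner (Ω : Phase N) (K : ℝ) (k : ℝ → ℝ) (x : Phase N) :
    potential Ω K k x = interactionPotential K k x - inner ℝ Ω x := by
  simp only [potential, PiLp.inner_apply, RCLike.inner_apply, conj_trivial, mul_comm (x _)]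
  ring

theorem hasGradientAt_potential {k : ℝ → ℝ} (hk : Function.Odd k) (hcont : Continuous k)
    (Ω : Phase N) (K : ℝ) (x : Phase N) :
    HasGradientAt (potential Ω K k) (-vectorField Ω K k x) x := by
  have hint := (hasGradientAt_interactionPotential hk hcont K x).hasFDerivAt
  rw [hasGradientAt_iff_hasFDerivAt, vectorField_eq_add, neg_add, neg_add_eq_sub, map_sub,
    funext (potential_eq_inner Ω K k)]
  exact hint.sub (InnerProductSpace.toDual ℝ (Phase N) Ω).hasFDerivAt

end GradientStructure

section Curves

theorem intervalIntegrable_of_continuousOn_Ici {E : Type*} [NormedAddCommGroup E] {f : ℝ → E}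
    {a s t : ℝ} (hf : ContinuousOn f (Ici a)) (hs : a ≤ s) (ht : a ≤ t) :
    IntervalIntegrable f volume s t :=
  (hf.mono (ordConnected_Ici.uIcc_subset hs ht)).intervalIntegrable

variable {E : Type*} [NormedAddCommGroup E] [NormedSpace ℝ E]

theorem norm_integral_sq_le [CompleteSpace E] {f : ℝ → E} {s t : ℝ} (hst : s ≤ t)
    (hf : IntervalIntegrable f volume s t)
    (hf2 : IntervalIntegrable (fun r => ‖f r‖ ^ 2) volume s t) :
    ‖∫ r in s..t, f r‖ ^ 2 ≤ (t - s) * ∫ r in s..t, ‖f r‖ ^ 2 := by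
  rcases hst.eq_or_lt with rfl | hlt
  · simp
  have hpos : 0 < t - s := sub_pos.2 hlt
  have hjensen : ‖⨍ r in s..t, f r‖ ^ 2 ≤ ⨍ r in s..t, ‖f r‖ ^ 2 := by
    rw [uIoc_of_le hst]
    exact ((convexOn_univ_norm (E := E)).pow (fun _ _ => norm_nonneg _) 2).map_set_average_le
      (continuous_norm.pow 2).continuousOn isClosed_univ (by simpa using hlt) (by simp) (by simp)
      ((intervalIntegrable_iff_integrableOn_Ioc_of_le hst).1 hf)
      ((intervalIntegrable_iff_integrableOn_Ioc_of_le hst).1 hf2)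
  rw [interval_average_eq, interval_average_eq, norm_smul, norm_inv, Real.norm_of_nonneg hpos.le,
    smul_eq_mul, mul_pow, inv_pow, inv_mul_eq_div, inv_mul_eq_div,
    div_le_div_iff₀ (pow_pos hpos 2) hpos] at hjensen
  nlinarith

/-- The curve `u` is continuously differentiable on `[0, ∞)`, with derivative `u'` (one-sided at
`0`). Nothing is required at negative times. This is the regularity of a classical solution, where
`u' = F ∘ u`. -/
structure IsC1Curve (u u' : ℝ → E) : Prop where
  hasDerivWithinAt : ∀ t, 0 ≤ t → HasDerivWithinAt u (u' t) (Ici 0) t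
  continuousOn_deriv : ContinuousOn u' (Ici 0)

theorem IsClassicalSolution.isC1Curve {N : ℕ} {F : Phase N → Phase N} {x₀ : Phase N}
    {u : ℝ → Phase N} (hu : IsClassicalSolution F x₀ u) (hF : Continuous F) :
    IsC1Curve u (F ∘ u) :=
  ⟨hu.2, hF.comp_continuousOn fun t ht => (hu.2 t ht).continuousWithinAt⟩

namespace IsC1Curve

variable {u u' : ℝ → E}

theorem continuousOn (hu : IsC1Curve u u') : ContinuousOn u (Ici 0) :=
  fun t ht => (hu.hasDerivWithinAt t ht).continuousWithinAt

theorem hasDerivAt (hu : IsC1Curve u u') {t : ℝ} (ht : 0 < t) : HasDerivAt u (u' t) t :=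
  (hu.hasDerivWithinAt t ht.le).hasDerivAt (Ici_mem_nhds ht)

theorem integral_norm_sq_deriv_eq (hu : IsC1Curve u u') {t : ℝ} (ht : 0 ≤ t) :
    ∫ s in (0 : ℝ)..t, ‖deriv u s‖ ^ 2 = ∫ s in (0 : ℝ)..t, ‖u' s‖ ^ 2 := by
  refine intervalIntegral.integral_congr_ae (Eventually.of_forall fun s hs => ?_)
  rw [uIoc_of_le ht] at hs
  rw [(hu.hasDerivAt hs.1).deriv]

theorem intervalIntegrable_norm_sq_deriv (hu : IsC1Curve u u') {s t : ℝ} (hs : 0 ≤ s)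
    (ht : 0 ≤ t) : IntervalIntegrable (fun r => ‖u' r‖ ^ 2) volume s t :=
  intervalIntegrable_of_continuousOn_Ici (hu.continuousOn_deriv.norm.pow 2) hs ht

variable [CompleteSpace E]

theorem integral_deriv (hu : IsC1Curve u u') {s t : ℝ} (hs : 0 ≤ s) (ht : 0 ≤ t) :
    ∫ r in s..t, u' r = u t - u s :=
  intervalIntegral.integral_eq_sub_of_hasDeriv_right
    (hu.continuousOn.mono (ordConnected_Ici.uIcc_subset hs ht))
    (fun _ hr => (hu.hasDerivAt ((le_min hs ht).trans_lt hr.1)).hasDerivWithinAt)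
    (intervalIntegrable_of_continuousOn_Ici hu.continuousOn_deriv hs ht)

theorem norm_sub_sq_le (hu : IsC1Curve u u') {s t T : ℝ} (hs : s ∈ Icc 0 T) (ht : t ∈ Icc 0 T) :
    ‖u t - u s‖ ^ 2 ≤ |t - s| * ∫ r in (0 : ℝ)..T, ‖u' r‖ ^ 2 := by
  wlog hst : s ≤ t generalizing s t
  · rw [norm_sub_rev, abs_sub_comm]
    exact this ht hs (le_of_not_ge hst)
  rw [← hu.integral_deriv hs.1 ht.1, abs_of_nonneg (sub_nonneg.2 hst)]
  refine (norm_integral_sq_le hst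
    (intervalIntegrable_of_continuousOn_Ici hu.continuousOn_deriv hs.1 ht.1)
    (hu.intervalIntegrable_norm_sq_deriv hs.1 ht.1)).trans ?_
  exact mul_le_mul_of_nonneg_left (intervalIntegral.integral_mono_interval hs.1 hst ht.2
    (Eventually.of_forall fun _ => sq_nonneg _)
    (hu.intervalIntegrable_norm_sq_deriv le_rfl (hs.1.trans hs.2))) (sub_nonneg.2 hst)

theorem norm_le (hu : IsC1Curve u u') {t T : ℝ} (ht : t ∈ Icc 0 T) :
    ‖u t‖ ≤ ‖u 0‖ + √(T * ∫ r in (0 : ℝ)..T, ‖u' r‖ ^ 2) := by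
  have hT : 0 ≤ T := ht.1.trans ht.2
  have hsub := hu.norm_sub_sq_le (left_mem_Icc.2 hT) ht
  rw [sub_zero, abs_of_nonneg ht.1] at hsub
  have hle : ‖u t - u 0‖ ≤ √(T * ∫ r in (0 : ℝ)..T, ‖u' r‖ ^ 2) :=
    Real.le_sqrt_of_sq_le (hsub.trans (mul_le_mul_of_nonneg_right ht.2
      (intervalIntegral.integral_nonneg hT fun _ _ => sq_nonneg _)))
  linarith [norm_le_norm_add_norm_sub' (u t) (u 0)]

end IsC1Curve

theorem IsC1Curve.integral_norm_sq_deriv_of_gradient {H : Type*} [NormedAddCommGroup H]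
    [InnerProductSpace ℝ H] [CompleteSpace H] {u u' : ℝ → H} (hu : IsC1Curve u u') {V : H → ℝ}
    (hV : ∀ s, 0 ≤ s → HasGradientAt V (-u' s) (u s)) {t : ℝ} (ht : 0 ≤ t) :
    ∫ s in (0 : ℝ)..t, ‖u' s‖ ^ 2 = V (u 0) - V (u t) := by
  have hVu : IsC1Curve (V ∘ u) fun s => -‖u' s‖ ^ 2 :=
    { hasDerivWithinAt := fun s hs => by
        have h := (hV s hs).hasFDerivAt.comp_hasDerivWithinAt s (hu.hasDerivWithinAt s hs)
        rwa [InnerProductSpace.toDual_apply_apply, inner_neg_left, real_inner_self_eq_norm_sq] at h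
      continuousOn_deriv := (hu.continuousOn_deriv.norm.pow 2).neg }
  have h := hVu.integral_deriv le_rfl ht
  rw [intervalIntegral.integral_neg] at h
  simp only [Function.comp_apply] at h
  linarith

end Curves

theorem energy_estimate {N : ℕ} {k : ℝ → ℝ} (hk : Function.Odd k) (hcont : Continuous k)
    (hpos : ∀ θ, 0 ≤ ∫ s in (0 : ℝ)..θ, k s) {Ω x₀ : Phase N} {K : ℝ} (hK : 0 ≤ K)
    {u : ℝ → Phase N} (hu : IsClassicalSolution (vectorField Ω K k) x₀ u) {t : ℝ} (ht : 0 ≤ t) :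
    1 / 2 * (∫ s in (0 : ℝ)..t, ‖vectorField Ω K k (u s)‖ ^ 2) ≤
      ‖Ω‖ ^ 2 / 2 * t + interactionPotential K k x₀ := by
  have hC1 := hu.isC1Curve (continuous_vectorField Ω K hcont)
  set D := ∫ s in (0 : ℝ)..t, ‖vectorField Ω K k (u s)‖ ^ 2
  have hD0 : 0 ≤ D := intervalIntegral.integral_nonneg ht fun _ _ => sq_nonneg _
  have hidentity : D = potential Ω K k x₀ - potential Ω K k (u t) := by
    rw [← hu.1]
    exact hC1.integral_norm_sq_deriv_of_gradient
      (fun s _ => hasGradientAt_potential hk hcont Ω K (u s)) ht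
  have hincrement : ‖u t - x₀‖ ^ 2 ≤ t * D := by
    have h := hC1.norm_sub_sq_le (left_mem_Icc.2 ht) (right_mem_Icc.2 ht)
    rwa [sub_zero, abs_of_nonneg ht, hu.1] at h
  have hdrift : inner ℝ Ω (u t - x₀) ≤ (‖Ω‖ ^ 2 * t + D) / 2 := by
    refine (real_inner_le_norm _ _).trans (abs_le_of_sq_le_sq' ?_ (by positivity)).2
    have := mul_le_mul_of_nonneg_left hincrement (sq_nonneg ‖Ω‖)
    nlinarith [sq_nonneg (‖Ω‖ ^ 2 * t - D)]
  have hnonneg := interactionPotential_nonneg hK hpos (u t)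
  rw [potential_eq_inner, potential_eq_inner] at hidentity
  rw [inner_sub_right] at hdrift
  linarith

section FilippovMap

variable {N : ℕ}

theorem mem_filippovMap_of_frequently {F : Phase N → Phase N} {x v : Phase N}
    (h : ∀ w : Phase N, ∀ a < inner ℝ w v, ∃ᶠ y in 𝓝 x,
      ContinuousAt (fun z => inner ℝ w (F z)) y ∧ a < inner ℝ w (F y)) :
    v ∈ filippovMap F x := by
  intro δ hδ S hS
  by_contra hmem
  obtain ⟨f, a, hle, hlt⟩ := geometric_hahn_banach_closed_point
    (convex_convexHull ℝ _).closure isClosed_closure hmem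
  obtain ⟨w, rfl⟩ := (InnerProductSpace.toDual ℝ (Phase N)).surjective f
  simp only [InnerProductSpace.toDual_apply_apply] at hle hlt
  obtain ⟨y, ⟨hcont, hy⟩, hball⟩ :=
    ((h w a hlt).and_eventually (Metric.isOpen_ball.mem_nhds (Metric.mem_ball_self hδ))).exists
  have hnear : ∀ᶠ z in 𝓝 y, z ∈ Metric.ball x δ ∧ a < inner ℝ w (F z) :=
    (Metric.isOpen_ball.eventually_mem hball).and (hcont.eventually (lt_mem_nhds hy))
  obtain ⟨z, ⟨hz, haz⟩, hzS⟩ : ∃ z, (z ∈ Metric.ball x δ ∧ a < inner ℝ w (F z)) ∧ z ∉ S := by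
    by_contra! hsub
    exact (Measure.measure_pos_of_mem_nhds volume hnear).ne' (measure_mono_null hsub hS)
  exact (hle _ (subset_closure (subset_convexHull ℝ _ ⟨z, ⟨hz, hzS⟩, rfl⟩))).not_gt haz

theorem tendsto_finsetSum_atTop {ι β : Type*} {l : Filter β} {s : Finset ι} {f : ι → β → ℝ}
    {i₀ : ι} (hi₀ : i₀ ∈ s) (h₀ : Tendsto (f i₀) l atTop)
    (h : ∀ i ∈ s, IsBoundedUnder (· ≥ ·) l (f i)) :
    Tendsto (fun b => ∑ i ∈ s, f i b) l atTop := by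
  classical
  choose! B hB using fun i hi => (h i hi).eventually_ge
  simp only [← Finset.add_sum_erase s _ hi₀]
  refine tendsto_atTop_add_right_of_le' l (∑ i ∈ s.erase i₀, B i) h₀ ?_
  filter_upwards [(Finset.eventually_all _).2 fun i hi => hB i (Finset.mem_of_mem_erase hi)]
    with b hb using Finset.sum_le_sum hb

/-- The direction `w` is constant on the clusters of the configuration `x`, that is, on the classes
of oscillators whose phases agree modulo `2π`. Along such directions the singular interactions
cancel and the vector field stays continuous at `x`. -/
def ConstantOnClusters (x w : Phase N) : Prop :=
  ∀ i j, (x i : Real.Angle) = x j → w i = w j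

theorem continuousAt_inner_vectorField {X : Type*} [TopologicalSpace X] {κ : X → ℝ → ℝ} {a : X}
    (hodd : ∀ b, Function.Odd (κ b))
    (hcont : ∀ θ : ℝ, (θ : Real.Angle) ≠ 0 → ContinuousAt (fun p : X × ℝ => κ p.1 p.2) (a, θ))
    (Ω : Phase N) (K : ℝ) {w y : Phase N} (h : ConstantOnClusters y w) :
    ContinuousAt (fun p : X × Phase N => inner ℝ w (vectorField Ω K (κ p.1) p.2)) (a, y) := by
  simp only [inner_vectorField (hodd _)]
  refine continuousAt_const.add (continuousAt_const.mul
    (tendsto_finsetSum _ fun i _ => tendsto_finsetSum _ fun j _ => ?_))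
  by_cases hij : w i = w j
  · simp only [hij, sub_self, zero_mul]
    exact tendsto_const_nhds
  have hne : ((y j - y i : ℝ) : Real.Angle) ≠ 0 := fun h0 => by
    rw [Real.Angle.coe_sub, sub_eq_zero] at h0
    exact hij (h i j h0.symm)
  exact continuousAt_const.mul (ContinuousAt.comp (x := (a, y))
    (f := fun p : X × Phase N => (p.1, p.2 j - p.2 i)) (hcont _ hne) (by fun_prop))

theorem eventually_angle_add_mul_ne_zero (b : ℝ) {a : ℝ} (ha : a ≠ 0) :
    ∀ᶠ r in 𝓝[>] (0 : ℝ), ((b + r * a : ℝ) : Real.Angle) ≠ 0 := by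
  by_cases hb : (b : Real.Angle) = 0
  · have hsmall : ∀ᶠ r in 𝓝[>] (0 : ℝ), r * a ∈ Ioo (-Real.pi) Real.pi :=
      nhdsWithin_le_nhds ((continuous_mul_const a).tendsto' 0 0 (zero_mul a)
        (Ioo_mem_nhds (neg_lt_zero.2 Real.pi_pos) Real.pi_pos))
    filter_upwards [hsmall, self_mem_nhdsWithin] with r hr hpos
    rw [Real.Angle.coe_add, hb, zero_add, ne_eq, ← Real.Angle.toReal_eq_zero_iff,
      Real.Angle.toReal_coe_eq_self_iff.2 ⟨hr.1, hr.2.le⟩]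
    exact mul_ne_zero (ne_of_gt hpos) ha
  · have hcont : ContinuousAt (fun r : ℝ => ((b + r * a : ℝ) : Real.Angle)) 0 :=
      Real.Angle.continuous_coe.continuousAt.comp (by fun_prop)
    refine nhdsWithin_le_nhds (hcont.eventually_ne ?_)
    rwa [zero_mul, add_zero]

theorem sub_smul_apply_sub (x w : Phase N) (r : ℝ) (i j : Fin N) :
    (x - r • w) j - (x - r • w) i = x j - x i + r * (w i - w j) := by
  simp only [PiLp.sub_apply, PiLp.smul_apply, smul_eq_mul]
  ring

theorem eventually_constantOnClusters_sub_smul (x w : Phase N) :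
    ∀ᶠ r in 𝓝[>] (0 : ℝ), ConstantOnClusters (x - r • w) w := by
  refine eventually_all.2 fun i => eventually_all.2 fun j => ?_
  by_cases hij : w i = w j
  · exact Eventually.of_forall fun _ _ => hij
  filter_upwards [eventually_angle_add_mul_ne_zero (x j - x i) (sub_ne_zero.2 hij)] with r hr h
  rw [← sub_smul_apply_sub, Real.Angle.coe_sub, h, sub_self] at hr
  exact absurd rfl hr

/-- An attractive kernel with an infinite jump at the collisions: `k` is odd, `2π`-periodic,
continuous off `2πℤ` and tends to `+∞` at `0` from the right. These are the only properties of
`singKernel α c` with `1 / 2 < α` that enter the description of its Filippov map. -/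
structure IsSupercriticalKernel (k : ℝ → ℝ) : Prop where
  odd : Function.Odd k
  periodic : Function.Periodic k (2 * Real.pi)
  continuousAt : ∀ θ : ℝ, (θ : Real.Angle) ≠ 0 → ContinuousAt k θ
  tendsto : Tendsto k (𝓝[>] 0) atTop

theorem isSupercriticalKernel_singKernel {α c : ℝ} (hc : 0 < c) (hα : 1 / 2 < α) :
    IsSupercriticalKernel (singKernel α c) where
  odd := singKernel_odd α c
  periodic := singKernel_periodic α c
  continuousAt _ := continuousAt_singKernel α hc
  tendsto := tendsto_singKernel_nhdsGT_zero hc hα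

namespace IsSupercriticalKernel

variable {k : ℝ → ℝ}

theorem tendsto_mul_add_mul (hk : IsSupercriticalKernel k) {a b : ℝ} (ha : a ≠ 0)
    (hb : (b : Real.Angle) = 0) :
    Tendsto (fun r => a * k (b + r * a)) (𝓝[>] 0) atTop := by
  have habs (r : ℝ) : a * k (b + r * a) = |a| * k (r * |a|) := by
    have hper : k (b + r * a) = k (r * a) := periodic_eq_of_angle_eq hk.periodic (by simp [hb])
    rcases abs_choice a with h | h <;> rw [hper, h]
    rw [mul_neg, hk.odd, neg_mul_neg]
  have hzero : Tendsto (fun r : ℝ => r * |a|) (𝓝[>] 0) (𝓝[>] 0) :=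
    tendsto_nhdsWithin_iff.2
      ⟨((continuous_mul_const |a|).tendsto' 0 0 (zero_mul _)).mono_left nhdsWithin_le_nhds,
        eventually_mem_nhdsWithin.mono fun r hr => mul_pos hr (abs_pos.2 ha)⟩
  simp only [habs]
  exact (hk.tendsto.comp hzero).const_mul_atTop (abs_pos.2 ha)

theorem isBoundedUnder_mul_add_mul (hk : IsSupercriticalKernel k) (a b : ℝ) :
    IsBoundedUnder (· ≥ ·) (𝓝[>] 0) fun r => a * k (b + r * a) := by
  rcases eq_or_ne a 0 with rfl | ha
  · simp only [zero_mul]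
    exact isBoundedUnder_const
  by_cases hb : (b : Real.Angle) = 0
  · exact (hk.tendsto_mul_add_mul ha hb).isBoundedUnder_ge_atTop
  have hcont : ContinuousAt (fun r : ℝ => a * k (b + r * a)) 0 :=
    continuousAt_const.mul (ContinuousAt.comp (f := fun r : ℝ => b + r * a)
      (by simpa using hk.continuousAt b hb) (by fun_prop))
  exact (hcont.tendsto.mono_left nhdsWithin_le_nhds).isBoundedUnder_ge

theorem tendsto_inner_vectorField (hk : IsSupercriticalKernel k) {K : ℝ} (hK : 0 < K)
    (Ω : Phase N) {x w : Phase N} (hw : ¬ConstantOnClusters x w) :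
    Tendsto (fun r : ℝ => inner ℝ w (vectorField Ω K k (x - r • w))) (𝓝[>] 0) atTop := by
  simp only [ConstantOnClusters, not_forall] at hw
  obtain ⟨i₀, j₀, hx, hne⟩ := hw
  have hN : (0 : ℝ) < N := Nat.cast_pos.2 i₀.pos
  have hpairs (r : ℝ) : ∑ i, ∑ j, (w i - w j) * k (x j - x i + r * (w i - w j)) =
      ∑ p : Fin N × Fin N, (w p.1 - w p.2) * k (x p.2 - x p.1 + r * (w p.1 - w p.2)) :=
    (Fintype.sum_prod_type' _).symm
  simp only [inner_vectorField hk.odd, sub_smul_apply_sub, hpairs]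
  refine tendsto_atTop_add_const_left _ _ (Tendsto.const_mul_atTop (by positivity)
    (tendsto_finsetSum_atTop (Finset.mem_univ (i₀, j₀)) ?_
      fun p _ => hk.isBoundedUnder_mul_add_mul _ _))
  refine hk.tendsto_mul_add_mul (sub_ne_zero.2 hne) ?_
  rw [Real.Angle.coe_sub, hx, sub_self]

theorem mem_filippovMap_vectorField (hk : IsSupercriticalKernel k) {K : ℝ} (hK : 0 < K)
    (Ω : Phase N) {x v : Phase N} (hv : ∀ w, ConstantOnClusters x w →
      inner ℝ w v = inner ℝ w (vectorField Ω K k x)) :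
    v ∈ filippovMap (vectorField Ω K k) x := by
  have hcont {y w : Phase N} (h : ConstantOnClusters y w) :
      ContinuousAt (fun z => inner ℝ w (vectorField Ω K k z)) y :=
    (continuousAt_inner_vectorField (κ := fun _ : Unit => k) (a := ()) (fun _ => hk.odd)
      (fun θ hθ => (hk.continuousAt θ hθ).comp continuousAt_snd) Ω K h).comp
      (f := fun z => ((), z)) (by fun_prop)
  refine mem_filippovMap_of_frequently fun w a ha => ?_
  by_cases hw : ConstantOnClusters x w
  · exact mem_closure_iff_frequently.1 (subset_closure ⟨hcont hw, by rwa [← hv w hw]⟩)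
  have hline : Tendsto (fun r : ℝ => x - r • w) (𝓝[>] 0) (𝓝 x) :=
    ((by fun_prop : Continuous fun r : ℝ => x - r • w).tendsto' 0 x (by simp)).mono_left
      nhdsWithin_le_nhds
  exact hline.frequently (((eventually_constantOnClusters_sub_smul x w).mono fun _ => hcont).and
    ((hk.tendsto_inner_vectorField hK Ω hw).eventually_gt_atTop a)).frequently

end IsSupercriticalKernel

end FilippovMap

section SobolevSpace

variable {N : ℕ} {T : ℝ}

theorem memLp_of_continuousOn_Ici {E : Type*} [NormedAddCommGroup E] {f : ℝ → E}
    (hf : ContinuousOn f (Ici 0)) (p : ℝ≥0∞) (T : ℝ) :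
    MemLp f p (volume.restrict (Ioo 0 T)) := by
  have hI : ContinuousOn f (Icc 0 T) := hf.mono Icc_subset_Ici_self
  obtain ⟨C, hC⟩ := isCompact_Icc.exists_bound_of_continuousOn hI
  refine MemLp.of_bound ((hI.mono Ioo_subset_Icc_self).aestronglyMeasurable measurableSet_Ioo) C ?_
  filter_upwards [ae_restrict_mem measurableSet_Ioo] with t ht
  exact hC t (Ioo_subset_Icc_self ht)

theorem norm_sq_toLp {E : Type*} [NormedAddCommGroup E] [InnerProductSpace ℝ E] {f : ℝ → E}
    (hT : 0 ≤ T) (hf : MemLp f 2 (volume.restrict (Ioo 0 T))) :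
    ‖hf.toLp f‖ ^ 2 = ∫ t in (0 : ℝ)..T, ‖f t‖ ^ 2 := by
  rw [← real_inner_self_eq_norm_sq, L2.inner_def, intervalIntegral.integral_of_le hT,
    integral_Ioc_eq_integral_Ioo]
  refine integral_congr_ae ?_
  filter_upwards [hf.coeFn_toLp] with t ht
  rw [ht, real_inner_self_eq_norm_sq]

theorem IsTestFunction.eq_zero {φ : ℝ → ℝ} (hφ : IsTestFunction T φ) {t : ℝ} (ht : t ∉ Ioo 0 T) :
    φ t = 0 :=
  image_eq_zero_of_notMem_tsupport fun h => ht (hφ.2.2 h)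

theorem IsC1Curve.integral_deriv_smul {E : Type*} [NormedAddCommGroup E] [NormedSpace ℝ E]
    [CompleteSpace E] {u u' : ℝ → E} (hu : IsC1Curve u u') (hT : 0 ≤ T) {φ : ℝ → ℝ}
    (hφ : IsTestFunction T φ) :
    ∫ t in Ioo 0 T, deriv φ t • u t = -∫ t in Ioo 0 T, φ t • u' t := by
  have hparts := intervalIntegral.integral_smul_deriv_eq_deriv_smul_of_hasDerivAt (a := 0) (b := T)
    (u := φ) (v := u) (v' := u') hφ.1.continuous.continuousOn
    (hu.continuousOn.mono (by simp [uIcc_of_le hT, Icc_subset_Ici_self]))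
    (fun t _ => (hφ.1.differentiable (by simp) t).hasDerivAt)
    (fun t ht => hu.hasDerivAt (by simpa [hT] using ht.1))
    ((hφ.1.continuous_deriv (by simp)).intervalIntegrable _ _)
    (intervalIntegrable_of_continuousOn_Ici hu.continuousOn_deriv le_rfl hT)
  rw [hφ.eq_zero (by simp), hφ.eq_zero (by simp), zero_smul, zero_smul, sub_zero, zero_sub,
    intervalIntegral.integral_of_le hT, intervalIntegral.integral_of_le hT,
    integral_Ioc_eq_integral_Ioo, integral_Ioc_eq_integral_Ioo] at hparts
  rw [hparts, neg_neg]

theorem IsC1Curve.exists_representsH1 {u u' : ℝ → Phase N} (hu : IsC1Curve u u') (hT : 0 ≤ T) :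
    ∃ p : H1 N T, RepresentsH1 p u ∧ p.1.snd =ᵐ[volume.restrict (Ioo 0 T)] u' ∧
      ‖p‖ ^ 2 = (∫ t in (0 : ℝ)..T, ‖u t‖ ^ 2) + ∫ t in (0 : ℝ)..T, ‖u' t‖ ^ 2 := by
  have hmem := memLp_of_continuousOn_Ici hu.continuousOn 2 T
  have hmem' := memLp_of_continuousOn_Ici hu.continuousOn_deriv 2 T
  have hcongr {f : ℝ → Phase N} (hf : MemLp f 2 (volume.restrict (Ioo 0 T))) (ψ : ℝ → ℝ) :
      ∫ t in Ioo 0 T, ψ t • hf.toLp f t = ∫ t in Ioo 0 T, ψ t • f t :=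
    integral_congr_ae (hf.coeFn_toLp.mono fun t ht => congrArg (ψ t • ·) ht)
  refine ⟨⟨WithLp.toLp 2 (hmem.toLp u, hmem'.toLp u'), fun φ hφ => ?_⟩, hmem.coeFn_toLp.symm,
    hmem'.coeFn_toLp, ?_⟩
  · exact (hcongr hmem _).trans
      ((hu.integral_deriv_smul hT hφ).trans (congrArg (- ·) (hcongr hmem' φ).symm))
  · rw [← norm_sq_toLp hT hmem, ← norm_sq_toLp hT hmem']
    exact WithLp.prod_norm_sq_eq_of_L2 _

theorem H1.snd_eq_zero_of_fst_eq_zero {p : H1 N T} (hp : p.1.fst = 0) : p.1.snd = 0 := by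
  have hint : IntegrableOn p.1.snd (Ioo 0 T) := (Lp.memLp p.1.snd).integrable (by norm_num)
  have hae := isOpen_Ioo.ae_eq_zero_of_integral_contDiff_smul_eq_zero
    hint.locallyIntegrableOn fun φ hφ hc hs => ?_
  · refine Lp.ext ?_
    filter_upwards [ae_restrict_of_ae hae, ae_restrict_mem measurableSet_Ioo,
      Lp.coeFn_zero (Phase N) 2 (volume.restrict (Ioo 0 T))] with t ht hmem hzero
    exact (ht hmem).trans hzero.symm
  have htest : IsTestFunction T φ := ⟨hφ, hc, hs⟩
  rw [← setIntegral_eq_integral_of_forall_compl_eq_zero (s := Ioo 0 T) fun t ht => by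
    rw [htest.eq_zero ht, zero_smul], ← neg_eq_zero, ← p.2 φ htest, hp]
  refine integral_eq_zero_of_ae ?_
  filter_upwards [Lp.coeFn_zero (Phase N) 2 (volume.restrict (Ioo 0 T))] with t hzero
  exact (congrArg _ hzero).trans (smul_zero _)

theorem RepresentsH1.unique {p q : H1 N T} {u : ℝ → Phase N} (hp : RepresentsH1 p u)
    (hq : RepresentsH1 q u) : p = q := by
  have hfst : p.1.fst = q.1.fst := Lp.ext (hp.symm.trans hq)
  have hsnd : (p - q).1.snd = 0 := H1.snd_eq_zero_of_fst_eq_zero (sub_eq_zero.2 hfst)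
  exact Subtype.ext (WithLp.ofLp_injective 2 (Prod.ext hfst (sub_eq_zero.1 hsnd)))

theorem RepresentsH1.snd_ae_eq {p : H1 N T} {u u' : ℝ → Phase N} (hp : RepresentsH1 p u)
    (hu : IsC1Curve u u') (hT : 0 ≤ T) : p.1.snd =ᵐ[volume.restrict (Ioo 0 T)] u' := by
  obtain ⟨q, hq, hsnd, -⟩ := hu.exists_representsH1 hT
  rwa [hp.unique hq]

theorem IsC1Curve.exists_representsH1_norm_le {u u' : ℝ → Phase N} (hu : IsC1Curve u u')
    (hT : 0 ≤ T) {E : ℝ} (hE : ∫ t in (0 : ℝ)..T, ‖u' t‖ ^ 2 ≤ E) :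
    ∃ p : H1 N T, RepresentsH1 p u ∧ ‖p‖ ≤ √(T * (‖u 0‖ + √(T * E)) ^ 2 + E) := by
  obtain ⟨p, hp, -, hnorm⟩ := hu.exists_representsH1 hT
  refine ⟨p, hp, Real.le_sqrt_of_sq_le (hnorm.trans_le (add_le_add ?_ hE))⟩
  calc ∫ t in (0 : ℝ)..T, ‖u t‖ ^ 2
      ≤ ∫ _ in (0 : ℝ)..T, (‖u 0‖ + √(T * E)) ^ 2 := by
        refine intervalIntegral.integral_mono_on hT (intervalIntegrable_of_continuousOn_Ici
          (hu.continuousOn.norm.pow 2) le_rfl hT) intervalIntegrable_const fun t ht => ?_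
        have := hu.norm_le ht
        gcongr
        exact this.trans (by gcongr)
    _ = T * (‖u 0‖ + √(T * E)) ^ 2 := by
        rw [intervalIntegral.integral_const, smul_eq_mul, sub_zero]

end SobolevSpace

section WeakConvergence

theorem tendsto_of_forall_clm_tendsto {E ι : Type*} [NormedAddCommGroup E] [NormedSpace ℝ E]
    [FiniteDimensional ℝ E] {l : Filter ι} {a : ι → E} {b : E}
    (h : ∀ ℓ : E →L[ℝ] ℝ, Tendsto (fun n => ℓ (a n)) l (𝓝 (ℓ b))) : Tendsto a l (𝓝 b) := by
  let e := (Module.finBasis ℝ E).equivFunL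
  have hcoord : Tendsto (e ∘ a) l (𝓝 (e b)) :=
    tendsto_pi_nhds.2 fun i => h
      (ContinuousLinearMap.proj (R := ℝ) (φ := fun _ => ℝ) i ∘L e.toContinuousLinearMap)
  exact e.toHomeomorph.isInducing.tendsto_nhds_iff.2 hcoord

variable {E X ι : Type*} [NormedAddCommGroup E] [InnerProductSpace ℝ E] [FiniteDimensional ℝ E]
  [MeasurableSpace X] {μ : Measure X} [IsFiniteMeasure μ] {l : Filter ι}
  {f : ι → Lp E 2 μ} {g : Lp E 2 μ}

theorem tendsto_setIntegral_of_forall_clm_tendsto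
    (h : ∀ ℓ : Lp E 2 μ →L[ℝ] ℝ, Tendsto (fun n => ℓ (f n)) l (𝓝 (ℓ g))) {A : Set X}
    (hA : MeasurableSet A) : Tendsto (fun n => ∫ t in A, f n t ∂μ) l (𝓝 (∫ t in A, g t ∂μ)) := by
  refine tendsto_of_forall_clm_tendsto fun ℓ => ?_
  obtain ⟨e, rfl⟩ := (InnerProductSpace.toDual ℝ E).surjective ℓ
  simpa only [InnerProductSpace.toDual_apply_apply, innerSL_apply_apply,
    L2.inner_indicatorConstLp_eq_inner_setIntegral] using
    h (innerSL ℝ (indicatorConstLp 2 hA (measure_ne_top μ A) e))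

theorem ae_eq_of_forall_clm_tendsto_of_bounded [l.NeBot] [l.IsCountablyGenerated]
    (h : ∀ ℓ : Lp E 2 μ →L[ℝ] ℝ, Tendsto (fun n => ℓ (f n)) l (𝓝 (ℓ g))) {G : X → E} {C : ℝ}
    (hbound : ∀ n, ∀ᵐ t ∂μ, ‖f n t‖ ≤ C)
    (hlim : ∀ᵐ t ∂μ, Tendsto (fun n => f n t) l (𝓝 (G t))) (hG : Integrable G μ) :
    G =ᵐ[μ] g := by
  refine hG.ae_eq_of_forall_setIntegral_eq _ _ ((Lp.memLp g).integrable (by norm_num))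
    fun A hA _ => tendsto_nhds_unique ?_ (tendsto_setIntegral_of_forall_clm_tendsto h hA)
  exact tendsto_integral_filter_of_dominated_convergence (fun _ => C)
    (Eventually.of_forall fun n => (Lp.aestronglyMeasurable (f n)).restrict)
    (Eventually.of_forall fun n => ae_restrict_of_ae (hbound n)) (integrable_const C)
    (ae_restrict_of_ae hlim)

end WeakConvergence

section Primitive

theorem absolutelyContinuousOnInterval_of_dist_le {X Y : Type*} [PseudoMetricSpace X]
    [PseudoMetricSpace Y] {f : ℝ → X} {g : ℝ → Y} {a b : ℝ}
    (hg : AbsolutelyContinuousOnInterval g a b)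
    (h : ∀ x ∈ uIcc a b, ∀ y ∈ uIcc a b, dist (f x) (f y) ≤ dist (g x) (g y)) :
    AbsolutelyContinuousOnInterval f a b := by
  rw [absolutelyContinuousOnInterval_iff] at hg ⊢
  intro η hη
  obtain ⟨δ, hδ, hE⟩ := hg η hη
  refine ⟨δ, hδ, fun E hEd hlt => (Finset.sum_le_sum fun i hi => ?_).trans_lt (hE E hEd hlt)⟩
  exact h _ (hEd.1 i hi).1 _ (hEd.1 i hi).2

theorem ae_restrict_Ioi_of_forall {P : ℝ → Prop}
    (h : ∀ T : ℝ, 0 < T → ∀ᵐ t ∂volume.restrict (Ioo 0 T), P t) :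
    ∀ᵐ t ∂volume.restrict (Ioi (0 : ℝ)), P t := by
  have hcover : Ioi (0 : ℝ) = ⋃ m : ℕ, Ioo 0 ((m : ℝ) + 1) := by
    refine Subset.antisymm (fun t ht => ?_) (iUnion_subset fun _ => Ioo_subset_Ioi_self)
    obtain ⟨m, hm⟩ := exists_nat_gt t
    exact mem_iUnion.2 ⟨m, ht, hm.trans (lt_add_one _)⟩
  rw [hcover, ae_restrict_iUnion_iff]
  exact fun m => h _ (by positivity)

variable {E : Type*} [NormedAddCommGroup E] [NormedSpace ℝ E]

/-- The primitive of `f` with value `x₀` at `0`. It serves as the absolutely continuous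
representative of a function with weak derivative `f`. -/
noncomputable def primitiveFrom (x₀ : E) (f : ℝ → E) (t : ℝ) : E := x₀ + ∫ s in (0 : ℝ)..t, f s

theorem primitiveFrom_zero (x₀ : E) (f : ℝ → E) : primitiveFrom x₀ f 0 = x₀ := by
  rw [primitiveFrom, intervalIntegral.integral_same, add_zero]

theorem absolutelyContinuousOnInterval_primitiveFrom {f : ℝ → E} {T : ℝ}
    (hf : IntervalIntegrable f volume 0 T) (x₀ : E) :
    AbsolutelyContinuousOnInterval (primitiveFrom x₀ f) 0 T := by
  refine absolutelyContinuousOnInterval_of_dist_le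
    (hf.norm.absolutelyContinuousOnInterval_intervalIntegral (c := 0) left_mem_uIcc)
    fun x hx y hy => ?_
  have hsub {z : ℝ} (hz : z ∈ uIcc 0 T) : IntervalIntegrable f volume 0 z :=
    hf.mono_set (uIcc_subset_uIcc left_mem_uIcc hz)
  rw [primitiveFrom, primitiveFrom, dist_add_left, dist_comm, dist_eq_norm,
    intervalIntegral.integral_interval_sub_left (hsub hy) (hsub hx), dist_comm, Real.dist_eq,
    intervalIntegral.integral_interval_sub_left (hsub hy).norm (hsub hx).norm]
  exact intervalIntegral.norm_integral_le_abs_integral_norm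

theorem ae_hasDerivAt_primitiveFrom [CompleteSpace E] {f : ℝ → E}
    (hf : ∀ T : ℝ, 0 ≤ T → IntervalIntegrable f volume 0 T) (x₀ : E) :
    ∀ᵐ t ∂volume.restrict (Ioi (0 : ℝ)), HasDerivAt (primitiveFrom x₀ f) (f t) t := by
  refine ae_restrict_Ioi_of_forall fun T hT => ?_
  filter_upwards [ae_restrict_of_ae (hf T hT.le).ae_hasDerivAt_integral,
    ae_restrict_mem measurableSet_Ioo] with t ht hmem
  exact (ht (Ioo_subset_Icc_self.trans Icc_subset_uIcc hmem) 0 left_mem_uIcc).const_add x₀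

end Primitive

namespace IsWeakH1LocLimit

variable {N : ℕ} {u u' : ℕ → ℝ → Phase N} {v v' : ℝ → Phase N} {x₀ : Phase N}

theorem intervalIntegrable (h : IsWeakH1LocLimit u v v') {T : ℝ} (hT : 0 ≤ T) :
    IntervalIntegrable v' volume 0 T := by
  rcases hT.eq_or_lt with rfl | hT
  · exact IntervalIntegrable.refl
  obtain ⟨-, q, -, -, hq, -⟩ := h T hT
  rw [intervalIntegrable_iff_integrableOn_Ioo_of_le hT.le]
  exact ((Lp.memLp q.1.snd).integrable (by norm_num)).congr hq.symm

theorem tendsto_apply (h : IsWeakH1LocLimit u v v') (hu : ∀ n, IsC1Curve (u n) (u' n))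
    (h₀ : ∀ n, u n 0 = x₀) {t : ℝ} (ht : 0 ≤ t) :
    Tendsto (fun n => u n t) atTop (𝓝 (primitiveFrom x₀ v' t)) := by
  rcases ht.eq_or_lt with rfl | ht
  · simp only [h₀, primitiveFrom_zero, tendsto_const_nhds]
  obtain ⟨p, q, hp, -, hq, hweak⟩ := h t ht
  have hint := tendsto_setIntegral_of_forall_clm_tendsto (f := fun n => (p n).1.snd)
    (g := q.1.snd) (fun ℓ => hweak (ℓ ∘L WithLp.sndL 2 ℝ (L2 N t) (L2 N t) ∘L (H1 N t).subtypeL))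
    MeasurableSet.univ
  have hcongr {f g : ℝ → Phase N} (hfg : f =ᵐ[volume.restrict (Ioo 0 t)] g) :
      ∫ s in Ioo 0 t, f s = ∫ s in (0 : ℝ)..t, g s := by
    rw [integral_congr_ae hfg, ← integral_Ioc_eq_integral_Ioo,
      ← intervalIntegral.integral_of_le ht.le]
  have hincrement (n : ℕ) : ∫ s in Ioo 0 t, (p n).1.snd s = u n t - x₀ := by
    rw [hcongr ((hp n).snd_ae_eq (hu n) ht.le), (hu n).integral_deriv le_rfl ht.le, h₀]
  simp only [Measure.restrict_univ, hincrement, hcongr hq.symm] at hint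
  simpa only [primitiveFrom, add_sub_cancel] using hint.const_add x₀

theorem primitiveFrom_ae_eq (h : IsWeakH1LocLimit u v v') (hu : ∀ n, IsC1Curve (u n) (u' n))
    (h₀ : ∀ n, u n 0 = x₀) (hbound : ∀ T, 0 < T → ∃ C, ∀ n, ∀ t ∈ Icc 0 T, ‖u n t‖ ≤ C) :
    primitiveFrom x₀ v' =ᵐ[volume.restrict (Ioi (0 : ℝ))] v := by
  refine ae_restrict_Ioi_of_forall fun T hT => ?_
  obtain ⟨C, hC⟩ := hbound T hT
  obtain ⟨p, q, hp, hv, -, hweak⟩ := h T hT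
  have hcont := (absolutelyContinuousOnInterval_primitiveFrom
    (h.intervalIntegrable hT.le) x₀).continuousOn
  rw [uIcc_of_le hT.le] at hcont
  refine EventuallyEq.trans ?_ hv.symm
  refine ae_eq_of_forall_clm_tendsto_of_bounded (C := C) (fun ℓ => hweak (ℓ ∘L
    WithLp.fstL 2 ℝ (L2 N T) (L2 N T) ∘L (H1 N T).subtypeL)) (fun n => ?_) ?_
    (hcont.integrableOn_Icc.mono_set Ioo_subset_Icc_self)
  · filter_upwards [hp n, ae_restrict_mem measurableSet_Ioo] with t hpt ht
    exact (congrArg norm hpt).symm.trans_le (hC n t (Ioo_subset_Icc_self ht))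
  · filter_upwards [ae_all_iff.2 hp, ae_restrict_mem measurableSet_Ioo] with t hpt ht
    exact (h.tendsto_apply hu h₀ ht.1.le).congr hpt

end IsWeakH1LocLimit

section Limit

theorem IsC1Curve.tendsto_prod_nhds {E ι : Type*} [NormedAddCommGroup E] [NormedSpace ℝ E]
    [CompleteSpace E] {l : Filter ι} {u u' : ι → ℝ → E} (hu : ∀ n, IsC1Curve (u n) (u' n))
    {T D : ℝ} (hD : ∀ n, ∫ r in (0 : ℝ)..T, ‖u' n r‖ ^ 2 ≤ D) {t : ℝ} (ht : t ∈ Ioo 0 T) {y : E}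
    (hlim : Tendsto (fun n => u n t) l (𝓝 y)) :
    Tendsto (fun p : ι × ℝ => u p.1 p.2) (l ×ˢ 𝓝 t) (𝓝 y) := by
  have hsq : Tendsto (fun p : ι × ℝ => ‖u p.1 p.2 - u p.1 t‖ ^ 2) (l ×ˢ 𝓝 t) (𝓝 0) := by
    have hzero : Tendsto (fun p : ι × ℝ => |p.2 - t| * D) (l ×ˢ 𝓝 t) (𝓝 0) :=
      ((by fun_prop : Continuous fun s : ℝ => |s - t| * D).tendsto' t 0 (by simp)).comp tendsto_snd
    refine squeeze_zero' (Eventually.of_forall fun _ => sq_nonneg _) ?_ hzero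
    filter_upwards [tendsto_snd.eventually (Icc_mem_nhds ht.1 ht.2)] with p hp
    exact ((hu p.1).norm_sub_sq_le (Ioo_subset_Icc_self ht) hp).trans
      (mul_le_mul_of_nonneg_left (hD p.1) (abs_nonneg _))
  have hsub : Tendsto (fun p : ι × ℝ => u p.1 p.2 - u p.1 t) (l ×ˢ 𝓝 t) (𝓝 0) :=
    tendsto_zero_iff_norm_tendsto_zero.2 (by simpa using hsq.sqrt)
  simpa using hsub.add (hlim.comp tendsto_fst)

theorem IsC1Curve.inner_deriv_eq_of_tendsto {E ι : Type*} [NormedAddCommGroup E]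
    [InnerProductSpace ℝ E] {l : Filter ι} [l.NeBot] {u u' : ι → ℝ → E} {Φ : ℝ → E}
    (hu : ∀ n, IsC1Curve (u n) (u' n))
    (hΦ : ∀ t, 0 ≤ t → Tendsto (fun n => u n t) l (𝓝 (Φ t))) {t : ℝ} (ht : 0 < t) {v w : E}
    (hv : HasDerivAt Φ v t) {L : ℝ}
    (hL : Tendsto (fun p : ι × ℝ => inner ℝ w (u' p.1 p.2)) (l ×ˢ 𝓝 t) (𝓝 L)) :
    inner ℝ w v = L := by
  have hderiv {f : ℝ → E} {f' : E} {s : ℝ} (hf : HasDerivAt f f' s) :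
      HasDerivAt (fun r => inner ℝ w (f r)) (inner ℝ w f') s := by
    simpa using (hasDerivAt_const s w).inner ℝ hf
  refine (hderiv hv).unique (hasDerivAt_of_tendstoUniformlyOnFilter (l := l) (g' := fun _ => L)
    (f := fun n s => inner ℝ w (u n s)) (f' := fun n s => inner ℝ w (u' n s))
    (tendstoUniformlyOnFilter_iff_tendsto.2 (Uniform.tendsto_nhds_right.1 hL)) ?_ ?_)
  · filter_upwards [tendsto_snd.eventually (lt_mem_nhds ht)] with p hp
    exact hderiv ((hu p.1).hasDerivAt hp)
  · filter_upwards [lt_mem_nhds ht] with s hs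
    exact tendsto_const_nhds.inner (hΦ s hs.le)

end Limit

section RegularizedFlow

variable {N : ℕ} {Ω x₀ : Phase N} {K c α : ℝ}

theorem continuous_vectorField_regKernel (Ω : Phase N) (K α : ℝ) (hc : 0 < c) {ε : ℝ}
    (hε : 0 < ε) : Continuous (vectorField Ω K (regKernel α c ε)) :=
  continuous_vectorField Ω K (continuous_regKernel α hc hε.ne')

theorem hasGradientAt_potential_regKernel (Ω : Phase N) (K α : ℝ) (hc : 0 < c) {ε : ℝ}
    (hε : 0 < ε) (x : Phase N) :
    HasGradientAt (potential Ω K (regKernel α c ε)) (-vectorField Ω K (regKernel α c ε) x) x :=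
  hasGradientAt_potential (regKernel_odd α c ε) (continuous_regKernel α hc hε.ne') Ω K x

theorem energy_estimate_regKernel (hK : 0 ≤ K) (hc : 0 < c) (hα : α ∈ Ico 0 1) {ε : ℝ}
    (hε : 0 < ε) {u : ℝ → Phase N}
    (hu : IsClassicalSolution (vectorField Ω K (regKernel α c ε)) x₀ u) {t : ℝ} (ht : 0 ≤ t) :
    1 / 2 * (∫ s in (0 : ℝ)..t, ‖vectorField Ω K (regKernel α c ε) (u s)‖ ^ 2) ≤
      ‖Ω‖ ^ 2 / 2 * t + interactionPotential K (singKernel α c) x₀ :=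
  (energy_estimate (regKernel_odd α c ε) (continuous_regKernel α hc hε.ne')
    (integral_regKernel_nonneg α hc hε.ne') hK hu ht).trans
    (add_le_add_right (interactionPotential_mono hK (integral_regKernel_le hc hα hε.ne') x₀) _)

theorem integral_norm_sq_regKernel_le (hK : 0 ≤ K) (hc : 0 < c) (hα : α ∈ Ico 0 1) {ε : ℝ}
    (hε : 0 < ε) {u : ℝ → Phase N}
    (hu : IsClassicalSolution (vectorField Ω K (regKernel α c ε)) x₀ u) {T : ℝ} (hT : 0 ≤ T) :
    ∫ s in (0 : ℝ)..T, ‖vectorField Ω K (regKernel α c ε) (u s)‖ ^ 2 ≤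
      ‖Ω‖ ^ 2 * T + 2 * interactionPotential K (singKernel α c) x₀ := by
  linarith [energy_estimate_regKernel hK hc hα hε hu hT]

theorem exists_forall_representsH1_norm_le (Ω x₀ : Phase N) (hK : 0 ≤ K) (hc : 0 < c)
    (hα : α ∈ Ico 0 1) {T : ℝ} (hT : 0 ≤ T) :
    ∃ C, ∀ ε, 0 < ε → ∀ u, IsClassicalSolution (vectorField Ω K (regKernel α c ε)) x₀ u →
      ∃ p : H1 N T, RepresentsH1 p u ∧ ‖p‖ ≤ C := by
  set D := ‖Ω‖ ^ 2 * T + 2 * interactionPotential K (singKernel α c) x₀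
  refine ⟨√(T * (‖x₀‖ + √(T * D)) ^ 2 + D), fun ε hε u hu => ?_⟩
  rw [← hu.1]
  exact (hu.isC1Curve (continuous_vectorField_regKernel Ω K α hc hε)).exists_representsH1_norm_le
    hT (integral_norm_sq_regKernel_le hK hc hα hε hu hT)

end RegularizedFlow

/-- The data of the singular limit: solutions `u n` of the regularized systems with vanishing
parameters `ε n` and common initial value `x₀`, converging weakly in `H¹_loc` to `Θ`, whose weak
derivative is `Θ'`. -/
structure IsSingularLimit {N : ℕ} (Ω x₀ : Phase N) (K c α : ℝ) (ε : ℕ → ℝ)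
    (u : ℕ → ℝ → Phase N) (Θ Θ' : ℝ → Phase N) : Prop where
  pos : ∀ n, 0 < ε n
  tendsto_zero : Tendsto ε atTop (𝓝 0)
  isClassicalSolution : ∀ n, IsClassicalSolution (vectorField Ω K (regKernel α c (ε n))) x₀ (u n)
  isWeakH1LocLimit : IsWeakH1LocLimit u Θ Θ'

namespace IsSingularLimit

variable {N : ℕ} {Ω x₀ : Phase N} {K c α : ℝ} {ε : ℕ → ℝ} {u : ℕ → ℝ → Phase N}
  {Θ Θ' : ℝ → Phase N}

theorem isC1Curve (h : IsSingularLimit Ω x₀ K c α ε u Θ Θ') (hc : 0 < c) (n : ℕ) :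
    IsC1Curve (u n) (vectorField Ω K (regKernel α c (ε n)) ∘ u n) :=
  (h.isClassicalSolution n).isC1Curve (continuous_vectorField_regKernel Ω K α hc (h.pos n))

theorem integral_norm_sq_le (h : IsSingularLimit Ω x₀ K c α ε u Θ Θ') (hK : 0 ≤ K) (hc : 0 < c)
    (hα : α ∈ Ico 0 1) {T : ℝ} (hT : 0 ≤ T) (n : ℕ) :
    ∫ s in (0 : ℝ)..T, ‖(vectorField Ω K (regKernel α c (ε n)) ∘ u n) s‖ ^ 2 ≤
      ‖Ω‖ ^ 2 * T + 2 * interactionPotential K (singKernel α c) x₀ :=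
  integral_norm_sq_regKernel_le hK hc hα (h.pos n) (h.isClassicalSolution n) hT

theorem tendsto_apply (h : IsSingularLimit Ω x₀ K c α ε u Θ Θ') (hc : 0 < c) {t : ℝ}
    (ht : 0 ≤ t) : Tendsto (fun n => u n t) atTop (𝓝 (primitiveFrom x₀ Θ' t)) :=
  h.isWeakH1LocLimit.tendsto_apply (h.isC1Curve hc) (fun n => (h.isClassicalSolution n).1) ht

theorem primitiveFrom_ae_eq (h : IsSingularLimit Ω x₀ K c α ε u Θ Θ') (hK : 0 ≤ K) (hc : 0 < c)
    (hα : α ∈ Ico 0 1) : primitiveFrom x₀ Θ' =ᵐ[volume.restrict (Ioi (0 : ℝ))] Θ := by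
  refine h.isWeakH1LocLimit.primitiveFrom_ae_eq (h.isC1Curve hc)
    (fun n => (h.isClassicalSolution n).1) fun T hT =>
      ⟨‖x₀‖ + √(T * (‖Ω‖ ^ 2 * T + 2 * interactionPotential K (singKernel α c) x₀)),
        fun n t ht => ?_⟩
  have hnorm := (h.isC1Curve hc n).norm_le ht
  rw [(h.isClassicalSolution n).1] at hnorm
  exact hnorm.trans (add_le_add_right (Real.sqrt_le_sqrt
    (mul_le_mul_of_nonneg_left (h.integral_norm_sq_le hK hc hα hT.le n) hT.le)) _)

theorem tendsto_inner_vectorField (h : IsSingularLimit Ω x₀ K c α ε u Θ Θ') (hK : 0 ≤ K)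
    (hc : 0 < c) (hα : α ∈ Ico 0 1) {t : ℝ} (ht : 0 < t) {w : Phase N}
    (hw : ConstantOnClusters (primitiveFrom x₀ Θ' t) w) :
    Tendsto (fun p : ℕ × ℝ =>
        inner ℝ w ((vectorField Ω K (regKernel α c (ε p.1)) ∘ u p.1) p.2)) (atTop ×ˢ 𝓝 t)
      (𝓝 (inner ℝ w (vectorField Ω K (singKernel α c) (primitiveFrom x₀ Θ' t)))) := by
  have hcurves : Tendsto (fun p : ℕ × ℝ => u p.1 p.2) (atTop ×ˢ 𝓝 t)
      (𝓝 (primitiveFrom x₀ Θ' t)) :=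
    IsC1Curve.tendsto_prod_nhds (h.isC1Curve hc)
      (h.integral_norm_sq_le hK hc hα (by linarith : 0 ≤ t + 1)) ⟨ht, lt_add_one t⟩
      (h.tendsto_apply hc ht.le)
  have hfields : ContinuousAt
      (fun p : ℝ × Phase N => inner ℝ w (vectorField Ω K (regKernel α c p.1) p.2))
      (0, primitiveFrom x₀ Θ' t) :=
    continuousAt_inner_vectorField (regKernel_odd α c)
      (fun _ hθ => continuousAt_regKernel α hc (Or.inr hθ)) Ω K hw
  rw [singKernel_eq_regKernel_zero α hc.le]
  have hargs : Tendsto (fun p : ℕ × ℝ => (ε p.1, u p.1 p.2)) (atTop ×ˢ 𝓝 t)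
      (𝓝 (0, primitiveFrom x₀ Θ' t)) :=
    (h.tendsto_zero.comp tendsto_fst).prodMk_nhds hcurves
  exact (hfields.tendsto.comp hargs :)

theorem ae_hasDerivAt (h : IsSingularLimit Ω x₀ K c α ε u Θ Θ') :
    ∀ᵐ t ∂volume.restrict (Ioi (0 : ℝ)), HasDerivAt (primitiveFrom x₀ Θ') (Θ' t) t :=
  ae_hasDerivAt_primitiveFrom (fun _ => h.isWeakH1LocLimit.intervalIntegrable) x₀

theorem ae_mem_filippovMap_primitiveFrom (h : IsSingularLimit Ω x₀ K c α ε u Θ Θ') (hK : 0 < K)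
    (hc : 0 < c) (hα : α ∈ Ioo (1 / 2 : ℝ) 1) :
    ∀ᵐ t ∂volume.restrict (Ioi (0 : ℝ)),
      Θ' t ∈ filippovMap (vectorField Ω K (singKernel α c)) (primitiveFrom x₀ Θ' t) := by
  have hα' : α ∈ Ico 0 1 := ⟨by linarith [hα.1], hα.2⟩
  filter_upwards [h.ae_hasDerivAt, ae_restrict_mem measurableSet_Ioi] with t hderiv ht
  refine (isSupercriticalKernel_singKernel hc hα.1).mem_filippovMap_vectorField hK Ω fun w hw => ?_
  exact IsC1Curve.inner_deriv_eq_of_tendsto (h.isC1Curve hc) (fun _ => h.tendsto_apply hc) ht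
    hderiv (h.tendsto_inner_vectorField hK.le hc hα' ht hw)

theorem ae_mem_filippovMap (h : IsSingularLimit Ω x₀ K c α ε u Θ Θ') (hK : 0 < K) (hc : 0 < c)
    (hα : α ∈ Ioo (1 / 2 : ℝ) 1) :
    ∀ᵐ t ∂volume.restrict (Ioi (0 : ℝ)),
      Θ' t ∈ filippovMap (vectorField Ω K (singKernel α c)) (Θ t) := by
  filter_upwards [h.ae_mem_filippovMap_primitiveFrom hK hc hα,
    h.primitiveFrom_ae_eq hK.le hc ⟨by linarith [hα.1], hα.2⟩] with t hmem heq
  rwa [← heq]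

theorem isFilippovSolution (h : IsSingularLimit Ω x₀ K c α ε u Θ Θ') (hK : 0 < K) (hc : 0 < c)
    (hα : α ∈ Ioo (1 / 2 : ℝ) 1) :
    IsFilippovSolution (vectorField Ω K (singKernel α c)) x₀ (primitiveFrom x₀ Θ') := by
  refine ⟨primitiveFrom_zero x₀ Θ', fun T hT => absolutelyContinuousOnInterval_primitiveFrom
    (h.isWeakH1LocLimit.intervalIntegrable hT.le) x₀, ?_⟩
  filter_upwards [h.ae_mem_filippovMap_primitiveFrom hK hc hα, h.ae_hasDerivAt] with t hmem hderiv
  exact ⟨Θ' t, hmem, hderiv⟩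

end IsSingularLimit

end SingularKuramoto

theorem mainTheorem7 (N : ℕ) (Ω Θ₀ : SingularKuramoto.Phase N) (K c α : ℝ)
    (hK : 0 < K) (hc : 0 < c) (hα : α ∈ Ioo (1 / 2 : ℝ) 1)
    (Θε : ℝ → ℝ → SingularKuramoto.Phase N)
    (hΘε : ∀ ε : ℝ, 0 < ε → SingularKuramoto.IsClassicalSolution
      (SingularKuramoto.vectorField Ω K (SingularKuramoto.regKernel α c ε)) Θ₀ (Θε ε)) :
    -- the regularized system is the gradient flow of the regularized potential
    (∀ ε : ℝ, 0 < ε → ∀ x : SingularKuramoto.Phase N,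
      HasGradientAt (SingularKuramoto.potential Ω K (SingularKuramoto.regKernel α c ε))
        (-SingularKuramoto.vectorField Ω K (SingularKuramoto.regKernel α c ε) x) x) ∧
    -- energy estimate
    (∀ ε : ℝ, 0 < ε → ∀ t : ℝ, 0 < t →
      1 / 2 * (∫ s in (0 : ℝ)..t, ‖deriv (Θε ε) s‖ ^ 2) ≤
        ‖Ω‖ ^ 2 / 2 * t +
          SingularKuramoto.interactionPotential K (SingularKuramoto.singKernel α c) Θ₀) ∧
    -- boundedness in `H¹_loc`, uniformly in `ε`
    (∀ T : ℝ, 0 < T → ∃ C : ℝ, ∀ ε : ℝ, 0 < ε → ∃ p : SingularKuramoto.H1 N T,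
      SingularKuramoto.RepresentsH1 p (Θε ε) ∧ ‖p‖ ≤ C) ∧
    -- every weak `H¹_loc` limit solves the differential inclusion and is a Filippov solution
    (∀ (ε : ℕ → ℝ), (∀ n, 0 < ε n) → Tendsto ε atTop (𝓝 0) →
      ∀ Θ Θ' : ℝ → SingularKuramoto.Phase N,
        SingularKuramoto.IsWeakH1LocLimit (fun n => Θε (ε n)) Θ Θ' →
        (∀ᵐ t ∂(volume.restrict (Ioi (0 : ℝ))), Θ' t ∈ SingularKuramoto.filippovMap
          (SingularKuramoto.vectorField Ω K (SingularKuramoto.singKernel α c)) (Θ t)) ∧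
        ∃ Φ : ℝ → SingularKuramoto.Phase N,
          Φ =ᵐ[volume.restrict (Ioi (0 : ℝ))] Θ ∧
          SingularKuramoto.IsFilippovSolution
            (SingularKuramoto.vectorField Ω K (SingularKuramoto.singKernel α c)) Θ₀ Φ) := by
  have hα₀ : α ∈ Ico 0 1 := ⟨by linarith [hα.1], hα.2⟩
  refine ⟨fun ε hε => SingularKuramoto.hasGradientAt_potential_regKernel Ω K α hc hε,
    fun ε hε t ht => ?_, fun T hT => ?_, fun ε hε hlim Θ Θ' hweak => ?_⟩
  · rw [((hΘε ε hε).isC1Curve (SingularKuramoto.continuous_vectorField_regKernel Ω K α hc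
      hε)).integral_norm_sq_deriv_eq ht.le]
    exact SingularKuramoto.energy_estimate_regKernel hK.le hc hα₀ hε (hΘε ε hε) ht.le
  · obtain ⟨C, hC⟩ :=
      SingularKuramoto.exists_forall_representsH1_norm_le Ω Θ₀ hK.le hc hα₀ hT.le
    exact ⟨C, fun ε hε => hC ε hε (Θε ε) (hΘε ε hε)⟩
  · have hsing : SingularKuramoto.IsSingularLimit Ω Θ₀ K c α ε (fun n => Θε (ε n)) Θ Θ' :=
      ⟨hε, hlim, fun n => hΘε (ε n) (hε n), hweak⟩
    exact ⟨hsing.ae_mem_filippovMap hK hc hα, _, hsing.primitiveFrom_ae_eq hK.le hc hα₀,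
      hsing.isFilippovSolution hK hc hα⟩
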